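/- Let $M$ be a smooth (Hausdorff, second countable, finite-dimensional) manifold and let $(A,[\cdot,\cdot],\rho)$ be a Lie algebroid of finite rank over $M$, with differential $\mathrm d$. Let $\phi_0$ be a smooth section of $A^*$ with $\mathrm d\phi_0=0$, i.e. $\rho(X)\langle\phi_0,Y\rangle-\rho(Y)\langle\phi_0,X\rangle-\langle\phi_0,[X,Y]\rangle=0$ for all sections $X,Y$ of $A$; the pair $(A,\phi_0)$ is called a Jacobi algebroid. On $A$-multivector fields let $[\cdot,\cdot]$ be the Schouten bracket, normalized by $[X,f]=\rho(X)f$, $[P,Q]=-(-1)^{(p-1)(q-1)}[Q,P]$ and $[P,Q\wedge R]=[P,Q]\wedge R+(-1)^{(p-1)q}Q\wedge[P,R]$ for $P\in\mathfrak X^p(A)$, $Q\in\mathfrak X^q(A)$, let $i_{\phi_0}$ be the interior product, $i_{\phi_0}(X\wedge Q)=\langle\phi_0,X\rangle Q-X\wedge i_{\phi_0}Q$, and let $$[P,Q]^{\phi_0}=[P,Q]+(p-1)\,P\wedge i_{\phi_0}Q-(-1)^{p-1}(q-1)\,i_{\phi_0}P\wedge Q .$$ For $P\in\mathfrak X^2(A)$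 let $P^\sharp:A^*\to A$ be given by $\langle\beta,P^\sharp\alpha\rangle=P(\alpha,\beta)$, and let $\rho^2:\mathfrak X^2(A)\to\mathfrak X^2(M)$ be the map induced by $\rho$. A Jacobi structure on $M$ is a pair $(\Lambda,E)$ of a bivector field and a vector field with $[\Lambda,\Lambda]=-2E\wedge\Lambda$ and $[E,\Lambda]=0$ (Schouten bracket of $TM$, with the same conventions). Two Jacobi structures $(\Lambda_1,E_1)$ and $(\Lambda_2,E_2)$ are compatible if $(\Lambda_1+\Lambda_2,E_1+E_2)$ is also a Jacobi structure. Theorem. Let $P_1,P_2\in\mathfrak X^2(A)$ be compatible Jacobi bivectors on $(A,\phi_0)$, that is, $[P_1,P_1]^{\phi_0}=0$, $[P_2,P_2]^{\phi_0}=0$ and $[P_1,P_2]^{\phi_0}=0$. Then $(\rho^2P_1,\rho(P_1^\sharp\phi_0))$ and $(\rho^2P_2,\rho(P_2^\sharp\phi_0))$ are Jacobi structures on $M$, and they are compatible. -/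

import Mathlib

open scoped Manifold ContDiff Bundle

noncomputable section

/-- Pairs of elements of a ring `E` with the multiplication
`(a, b) * (a', b') = (a * a', τ a * b' + b * a')`.  A ring homomorphism `a ↦ (a, D a)` into it is
the same as an additive map `D` with `D (a * a') = τ a * D a' + D a * a'`. -/
@[ext] structure TwistedExt {E : Type*} [Ring E] (τ : E →+* E) where
  fst : E
  snd : E

namespace TwistedExt

variable {E : Type*} [Ring E] {τ : E →+* E}

instance : Zero (TwistedExt τ) := ⟨⟨0, 0⟩⟩
instance : One (TwistedExt τ) := ⟨⟨1, 0⟩⟩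
instance : Add (TwistedExt τ) := ⟨fun x y => ⟨x.fst + y.fst, x.snd + y.snd⟩⟩
instance : Neg (TwistedExt τ) := ⟨fun x => ⟨-x.fst, -x.snd⟩⟩
instance : Mul (TwistedExt τ) :=
  ⟨fun x y => ⟨x.fst * y.fst, τ x.fst * y.snd + x.snd * y.fst⟩⟩

@[simp] theorem zero_fst : (0 : TwistedExt τ).fst = 0 := rfl
@[simp] theorem zero_snd : (0 : TwistedExt τ).snd = 0 := rfl
@[simp] theorem one_fst : (1 : TwistedExt τ).fst = 1 := rfl
@[simp] theorem one_snd : (1 : TwistedExt τ).snd = 0 := rfl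
@[simp] theorem add_fst (x y : TwistedExt τ) : (x + y).fst = x.fst + y.fst := rfl
@[simp] theorem add_snd (x y : TwistedExt τ) : (x + y).snd = x.snd + y.snd := rfl
@[simp] theorem neg_fst (x : TwistedExt τ) : (-x).fst = -x.fst := rfl
@[simp] theorem neg_snd (x : TwistedExt τ) : (-x).snd = -x.snd := rfl
@[simp] theorem mul_fst (x y : TwistedExt τ) : (x * y).fst = x.fst * y.fst := rfl
@[simp] theorem mul_snd (x y : TwistedExt τ) :
    (x * y).snd = τ x.fst * y.snd + x.snd * y.fst := rfl

instance : Ring (TwistedExt τ) :=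
  Ring.ofMinimalAxioms
    (fun x y z => by ext <;> simp [add_assoc])
    (fun x => by ext <;> simp)
    (fun x => by ext <;> simp)
    (fun x y z => by ext <;> simp [mul_assoc, mul_add, add_mul, add_assoc])
    (fun x => by ext <;> simp)
    (fun x => by ext <;> simp)
    (fun x y z => by ext <;> simp [mul_add]; abel)
    (fun x y z => by ext <;> simp [add_mul]; abel)

end TwistedExt

namespace ExteriorAlgebra

section TwistedDerivation

variable {R L : Type*} [CommRing R] [AddCommGroup L] [Module R L]

/-- Data from which a twisted derivation of the exterior algebra is built. -/
structure TwistedDerivationData (τ : ExteriorAlgebra R L →ₐ[R] ExteriorAlgebra R L) where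
  onScalar : R →+ ExteriorAlgebra R L
  onVector : L →+ ExteriorAlgebra R L
  onScalar_mul : ∀ f g : R, onScalar (f * g) =
    algebraMap R (ExteriorAlgebra R L) f * onScalar g +
      onScalar f * algebraMap R (ExteriorAlgebra R L) g
  onScalar_comm : ∀ (f : R) (a : ExteriorAlgebra R L), onScalar f * a = τ a * onScalar f
  onVector_smul : ∀ (f : R) (Y : L), onVector (f • Y) = f • onVector Y + onScalar f * ι R Y
  onVector_sq : ∀ Y : L, τ (ι R Y) * onVector Y + onVector Y * ι R Y = 0

namespace TwistedDerivationData

variable {τ : ExteriorAlgebra R L →ₐ[R] ExteriorAlgebra R L} (D : TwistedDerivationData τ)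

/-- The ring homomorphism `f ↦ (f, D f)` on scalars. -/
def scalarHom : R →+* TwistedExt (τ : ExteriorAlgebra R L →+* ExteriorAlgebra R L) where
  toFun f := ⟨algebraMap R _ f, D.onScalar f⟩
  map_one' := by
    have h := D.onScalar_mul 1 1
    simp only [mul_one, map_one, one_mul, left_eq_add] at h
    ext <;> simp [h]
  map_mul' f g := by
    ext <;> simp [D.onScalar_mul]
  map_zero' := by ext <;> simp
  map_add' f g := by ext <;> simp

@[simp] theorem scalarHom_fst (f : R) : (D.scalarHom f).fst = algebraMap R _ f := rfl
@[simp] theorem scalarHom_snd (f : R) : (D.scalarHom f).snd = D.onScalar f := rfl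

theorem scalarHom_comm (f : R)
    (x : TwistedExt (τ : ExteriorAlgebra R L →+* ExteriorAlgebra R L)) :
    D.scalarHom f * x = x * D.scalarHom f := by
  ext
  · exact Algebra.commutes _ _
  · simp only [TwistedExt.mul_snd, scalarHom_fst, scalarHom_snd, RingHom.coe_coe,
      AlgHom.commutes, D.onScalar_comm]
    rw [add_comm, Algebra.commutes]

/-- The ring homomorphism `a ↦ (a, D a)`. -/
def extHom : ExteriorAlgebra R L →+*
    TwistedExt (τ : ExteriorAlgebra R L →+* ExteriorAlgebra R L) :=
  letI : Algebra R (TwistedExt (τ : ExteriorAlgebra R L →+* ExteriorAlgebra R L)) :=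
    D.scalarHom.toAlgebra' D.scalarHom_comm
  (ExteriorAlgebra.lift R
    ⟨{  toFun := fun Y => ⟨ι R Y, D.onVector Y⟩
        map_add' := fun Y Z => by ext <;> simp
        map_smul' := fun f Y => by
          rw [RingHom.id_apply, Algebra.smul_def]
          change _ = D.scalarHom f * _
          ext <;> simp [D.onVector_smul, Algebra.smul_def] },
      fun Y => TwistedExt.ext (ι_sq_zero Y) (D.onVector_sq Y)⟩ :
    ExteriorAlgebra R L →ₐ[R]
      TwistedExt (τ : ExteriorAlgebra R L →+* ExteriorAlgebra R L)).toRingHom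

theorem extHom_algebraMap (f : R) :
    D.extHom (algebraMap R _ f) = ⟨algebraMap R _ f, D.onScalar f⟩ := by
  let : Algebra R (TwistedExt (τ : ExteriorAlgebra R L →+* ExteriorAlgebra R L)) :=
    D.scalarHom.toAlgebra' D.scalarHom_comm
  exact AlgHom.commutes _ f

theorem extHom_ι (Y : L) : D.extHom (ι R Y) = ⟨ι R Y, D.onVector Y⟩ := by
  let : Algebra R (TwistedExt (τ : ExteriorAlgebra R L →+* ExteriorAlgebra R L)) :=
    D.scalarHom.toAlgebra' D.scalarHom_comm
  exact lift_ι_apply R _ _ Y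

theorem extHom_fst (a : ExteriorAlgebra R L) : (D.extHom a).fst = a := by
  induction a using ExteriorAlgebra.induction with
  | algebraMap f => rw [extHom_algebraMap]
  | ι Y => rw [extHom_ι]
  | mul a b ha hb => rw [map_mul, TwistedExt.mul_fst, ha, hb]
  | add a b ha hb => rw [map_add, TwistedExt.add_fst, ha, hb]

/-- The additive map `D` on the exterior algebra determined by its values on scalars and on vectors
and by `D (a * b) = τ a * D b + D a * b`. -/
def toAddHom : ExteriorAlgebra R L →+ ExteriorAlgebra R L where
  toFun a := (D.extHom a).snd
  map_zero' := by simp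
  map_add' a b := by simp

theorem toAddHom_algebraMap (f : R) : D.toAddHom (algebraMap R _ f) = D.onScalar f := by
  change (D.extHom _).snd = _
  rw [extHom_algebraMap]

theorem toAddHom_ι (Y : L) : D.toAddHom (ι R Y) = D.onVector Y := by
  change (D.extHom _).snd = _
  rw [extHom_ι]

theorem toAddHom_mul (a b : ExteriorAlgebra R L) :
    D.toAddHom (a * b) = τ a * D.toAddHom b + D.toAddHom a * b := by
  change (D.extHom _).snd = τ a * (D.extHom b).snd + (D.extHom a).snd * b
  rw [map_mul, TwistedExt.mul_snd]
  simp only [extHom_fst, RingHom.coe_coe]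

end TwistedDerivationData

end TwistedDerivation

section Degree

variable {R L : Type*} [CommRing R] [AddCommGroup L] [Module R L]

theorem mem_degree_zero {P : ExteriorAlgebra R L} :
    P ∈ ⋀[R]^0 L ↔ ∃ f : R, algebraMap R (ExteriorAlgebra R L) f = P := by
  change P ∈ (LinearMap.range (ι R : L →ₗ[R] ExteriorAlgebra R L)) ^ 0 ↔ _
  rw [pow_zero, Submodule.mem_one]

theorem mem_degree_one {P : ExteriorAlgebra R L} : P ∈ ⋀[R]^1 L ↔ ∃ X : L, ι R X = P := by
  change P ∈ (LinearMap.range (ι R : L →ₗ[R] ExteriorAlgebra R L)) ^ 1 ↔ _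
  rw [pow_one, LinearMap.mem_range]

theorem degree_succ (p : ℕ) :
    ⋀[R]^(p + 1) L = LinearMap.range (ι R : L →ₗ[R] ExteriorAlgebra R L) * ⋀[R]^p L :=
  pow_succ' _ _

/-- The interior product `i_α` by a one-form: `i_α (X ∧ Q) = α X • Q - X ∧ i_α Q`. -/
def contract : Module.Dual R L →ₗ[R] ExteriorAlgebra R L →ₗ[R] ExteriorAlgebra R L :=
  CliffordAlgebra.contractLeft

theorem contract_algebraMap (α : Module.Dual R L) (f : R) :
    contract α (algebraMap R (ExteriorAlgebra R L) f) = 0 :=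
  CliffordAlgebra.contractLeft_algebraMap _ _ _

theorem contract_ι (α : Module.Dual R L) (X : L) :
    contract α (ι R X) = algebraMap R (ExteriorAlgebra R L) (α X) :=
  CliffordAlgebra.contractLeft_ι _ _ _

theorem contract_ι_mul (α : Module.Dual R L) (X : L) (Q : ExteriorAlgebra R L) :
    contract α (ι R X * Q) = α X • Q - ι R X * contract α Q :=
  CliffordAlgebra.contractLeft_ι_mul _ _ _

theorem contract_of_degree_zero (α : Module.Dual R L) {P : ExteriorAlgebra R L}
    (hP : P ∈ ⋀[R]^0 L) : contract α P = 0 := by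
  rw [mem_degree_zero] at hP
  obtain ⟨f, rfl⟩ := hP
  exact contract_algebraMap α f

theorem contract_mem (α : Module.Dual R L) : ∀ (p : ℕ) {P : ExteriorAlgebra R L},
    P ∈ ⋀[R]^(p + 1) L → contract α P ∈ ⋀[R]^p L := by
  intro p
  induction p with
  | zero =>
    intro P hP
    rw [zero_add, mem_degree_one] at hP
    obtain ⟨X, rfl⟩ := hP
    rw [contract_ι, mem_degree_zero]
    exact ⟨_, rfl⟩
  | succ p ih =>
    intro P hP
    rw [degree_succ] at hP
    induction hP using Submodule.mul_induction_on' with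
    | mem_mul_mem m hm n hn =>
      obtain ⟨X, rfl⟩ := hm
      rw [contract_ι_mul]
      refine Submodule.sub_mem _ (Submodule.smul_mem _ _ hn) ?_
      rw [degree_succ]
      exact Submodule.mul_mem_mul ⟨X, rfl⟩ (ih hn)
    | add x _ y _ hx hy => rw [map_add]; exact Submodule.add_mem _ hx hy

/-- The grading automorphism to the power `k`: multiplication by `(-1)^(k q)` in degree `q`. -/
def gradeSign (k : ℕ) : ExteriorAlgebra R L →ₐ[R] ExteriorAlgebra R L :=
  (CliffordAlgebra.involute : ExteriorAlgebra R L →ₐ[R] ExteriorAlgebra R L) ^ k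

theorem gradeSign_ι (k : ℕ) (X : L) : gradeSign k (ι R X) = (-1 : R) ^ k • ι R X := by
  induction k with
  | zero => simp [gradeSign]
  | succ k ih =>
    rw [gradeSign, pow_succ', AlgHom.mul_apply]
    change CliffordAlgebra.involute (gradeSign k (ι R X)) = _
    rw [ih, map_smul]
    change _ • CliffordAlgebra.involute (CliffordAlgebra.ι _ X) = _
    rw [CliffordAlgebra.involute_ι, pow_succ]
    simp [ι]

theorem gradeSign_of_mem (k : ℕ) : ∀ (q : ℕ) {Q : ExteriorAlgebra R L}, Q ∈ ⋀[R]^q L →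
    gradeSign k Q = (-1 : R) ^ (k * q) • Q := by
  intro q
  induction q with
  | zero =>
    intro Q hQ
    rw [mem_degree_zero] at hQ
    obtain ⟨f, rfl⟩ := hQ
    simp
  | succ q ih =>
    intro Q hQ
    rw [degree_succ] at hQ
    induction hQ using Submodule.mul_induction_on' with
    | mem_mul_mem m hm n hn =>
      obtain ⟨X, rfl⟩ := hm
      rw [map_mul, gradeSign_ι, ih hn, smul_mul_smul_comm, ← pow_add]
      congr 2; ring
    | add x _ y _ hx hy => rw [map_add, hx, hy, smul_add]

theorem gradeSign_add_two (k : ℕ) :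
    (gradeSign (k + 2) : ExteriorAlgebra R L →ₐ[R] ExteriorAlgebra R L) = gradeSign k := by
  refine hom_ext ?_
  ext X
  simp [gradeSign_ι, pow_add]

theorem vector_mul_comm (X : L) (a : ExteriorAlgebra R L) :
    ι R X * a = gradeSign 1 a * ι R X := by
  induction a using ExteriorAlgebra.induction with
  | algebraMap f => rw [AlgHom.commutes, Algebra.commutes]
  | ι Y =>
    rw [gradeSign_ι, pow_one, neg_smul, one_smul, neg_mul, eq_neg_iff_add_eq_zero]
    exact ι_add_mul_swap X Y
  | mul a b ha hb => rw [← mul_assoc, ha, mul_assoc, hb, map_mul, mul_assoc]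
  | add a b ha hb => rw [mul_add, ha, hb, map_add, add_mul]

/-- Graded commutativity of the wedge product. -/
theorem mul_comm_of_mem : ∀ (k : ℕ) {b : ExteriorAlgebra R L}, b ∈ ⋀[R]^k L →
    ∀ a : ExteriorAlgebra R L, b * a = gradeSign k a * b := by
  intro k
  induction k with
  | zero =>
    intro b hb a
    rw [mem_degree_zero] at hb
    obtain ⟨f, rfl⟩ := hb
    rw [Algebra.commutes]; simp [gradeSign]
  | succ k ih =>
    intro b hb a
    rw [degree_succ] at hb
    induction hb using Submodule.mul_induction_on' with
    | mem_mul_mem m hm n hn =>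
      obtain ⟨X, rfl⟩ := hm
      rw [mul_assoc, ih hn, ← mul_assoc, vector_mul_comm, mul_assoc, ]
      congr 1
      rw [gradeSign, gradeSign, gradeSign, pow_one, pow_succ', AlgHom.mul_apply]
    | add x _ y _ hx hy => rw [add_mul, hx, hy, mul_add]

end Degree

end ExteriorAlgebra

/-- A skew-symmetric bracket on an `R`-module `L` that satisfies the Leibniz rule with respect to
an action of `L` on `R` by derivations.  Such a bracket extends to a Schouten bracket. -/
structure LeibnizBracket (k R L : Type*) [CommRing k] [CommRing R] [Algebra k R] [AddCommGroup L]
    [Module R L] [Module k L] where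
  bracket : L →ₗ[k] L →ₗ[k] L
  act : L →ₗ[R] Derivation k R R
  bracket_self : ∀ X, bracket X X = 0
  leibniz : ∀ (X Y : L) (f : R), bracket X (f • Y) = f • bracket X Y + act X f • Y

namespace LeibnizBracket

open ExteriorAlgebra

variable {k R L : Type*} [CommRing k] [CommRing R] [Algebra k R] [AddCommGroup L]
    [Module R L] [Module k L] (B : LeibnizBracket k R L)

theorem bracket_swap (X Y : L) : B.bracket X Y = -B.bracket Y X := by
  have h := B.bracket_self (X + Y)
  simp only [map_add, LinearMap.add_apply, B.bracket_self, zero_add, add_zero] at h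
  exact (eq_neg_of_add_eq_zero_right h)

/-- The differential of a function, `⟨d f, X⟩ = act X f`. -/
def d (f : R) : Module.Dual R L where
  toFun X := B.act X f
  map_add' X Y := by rw [map_add]; rfl
  map_smul' g X := by rw [map_smul]; rfl

@[simp] theorem d_apply (f : R) (X : L) : B.d f X = B.act X f := rfl

theorem d_add (f g : R) : B.d (f + g) = B.d f + B.d g := by ext X; simp

theorem d_mul (f g : R) : B.d (f * g) = f • B.d g + g • B.d f := by ext X; simp

theorem d_zero : B.d 0 = 0 := by ext X; simp

/-- The values of the Lie derivative along `X` on functions and on sections. -/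
def lieData (X : L) : TwistedDerivationData (AlgHom.id R (ExteriorAlgebra R L)) where
  onScalar :=
    { toFun := fun f => algebraMap R _ (B.act X f)
      map_zero' := by simp
      map_add' := by simp }
  onVector :=
    { toFun := fun Y => ι R (B.bracket X Y)
      map_zero' := by simp
      map_add' := by simp }
  onScalar_mul f g := by
    simp only [AddMonoidHom.coe_mk, ZeroHom.coe_mk, Derivation.leibniz, smul_eq_mul, map_add,
      map_mul]
    rw [Algebra.commutes g]
  onScalar_comm f a := by
    exact Algebra.commutes (B.act X f) a
  onVector_smul f Y := by
    simp only [AddMonoidHom.coe_mk, ZeroHom.coe_mk, B.leibniz, map_add, map_smul,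
      Algebra.smul_def]
  onVector_sq Y := ι_add_mul_swap _ _

/-- The Lie derivative `L_X` on the exterior algebra: the derivation that is `act X` on functions
and `[X, ·]` on sections. -/
def lieDeriv (X : L) : ExteriorAlgebra R L →+ ExteriorAlgebra R L := (B.lieData X).toAddHom

theorem lieDeriv_algebraMap (X : L) (f : R) :
    B.lieDeriv X (algebraMap R _ f) = algebraMap R _ (B.act X f) :=
  TwistedDerivationData.toAddHom_algebraMap _ f

theorem lieDeriv_ι (X Y : L) : B.lieDeriv X (ι R Y) = ι R (B.bracket X Y) :=
  TwistedDerivationData.toAddHom_ι _ Y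

theorem lieDeriv_mul (X : L) (a b : ExteriorAlgebra R L) :
    B.lieDeriv X (a * b) = a * B.lieDeriv X b + B.lieDeriv X a * b :=
  TwistedDerivationData.toAddHom_mul _ a b

theorem lieDeriv_mem (X : L) : ∀ (p : ℕ) {P : ExteriorAlgebra R L}, P ∈ ⋀[R]^p L →
    B.lieDeriv X P ∈ ⋀[R]^p L := by
  intro p
  induction p with
  | zero =>
    intro P hP
    rw [mem_degree_zero] at hP
    obtain ⟨f, rfl⟩ := hP
    rw [lieDeriv_algebraMap, mem_degree_zero]
    exact ⟨_, rfl⟩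
  | succ p ih =>
    intro P hP
    rw [degree_succ] at hP
    induction hP using Submodule.mul_induction_on' with
    | mem_mul_mem m hm n hn =>
      obtain ⟨Y, rfl⟩ := hm
      rw [lieDeriv_mul, lieDeriv_ι, degree_succ]
      exact Submodule.add_mem _ (Submodule.mul_mem_mul ⟨Y, rfl⟩ (ih hn))
        (Submodule.mul_mem_mul ⟨_, rfl⟩ hn)
    | add x _ y _ hx hy => rw [map_add]; exact Submodule.add_mem _ hx hy

theorem lieDeriv_add (X Y : L) (P : ExteriorAlgebra R L) :
    B.lieDeriv (X + Y) P = B.lieDeriv X P + B.lieDeriv Y P := by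
  induction P using ExteriorAlgebra.induction with
  | algebraMap f => simp only [lieDeriv_algebraMap, map_add, Derivation.add_apply]
  | ι Z => simp only [lieDeriv_ι, map_add, LinearMap.add_apply]
  | mul a b ha hb => simp only [lieDeriv_mul, ha, hb, mul_add, add_mul]; abel
  | add a b ha hb => simp only [map_add, ha, hb]; abel

theorem lieDeriv_smul (f : R) (X : L) (P : ExteriorAlgebra R L) :
    B.lieDeriv (f • X) P = f • B.lieDeriv X P - ι R X * contract (B.d f) P := by
  induction P using CliffordAlgebra.left_induction with
  | algebraMap g =>
    change B.lieDeriv (f • X) (algebraMap R (ExteriorAlgebra R L) g) =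
      f • B.lieDeriv X (algebraMap R (ExteriorAlgebra R L) g) -
        ι R X * contract (B.d f) (algebraMap R (ExteriorAlgebra R L) g)
    rw [lieDeriv_algebraMap, lieDeriv_algebraMap, contract_algebraMap, mul_zero, sub_zero,
      map_smul, Derivation.smul_apply, smul_eq_mul, map_mul, Algebra.smul_def]
  | add a b ha hb => 
    simp only [map_add, mul_add, smul_add] at ha hb ⊢
    rw [ha, hb]; abel
  | ι_mul P Y hP =>
    change B.lieDeriv (f • X) (ι R Y * P) =
      f • B.lieDeriv X (ι R Y * P) - ι R X * contract (B.d f) (ι R Y * P)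
    have h1 : B.bracket (f • X) Y = f • B.bracket X Y - B.act Y f • X := by
      rw [bracket_swap, B.leibniz, bracket_swap B Y X]; simp only [smul_neg]; abel
    have h2 : ι R X * (ι R Y * contract (B.d f) P) = - (ι R Y * (ι R X * contract (B.d f) P)) := by
      rw [← mul_assoc, ← mul_assoc, ← neg_mul, eq_neg_of_add_eq_zero_left (ι_add_mul_swap X Y)]
    rw [lieDeriv_mul, lieDeriv_mul, hP, lieDeriv_ι, lieDeriv_ι, h1, contract_ι_mul, map_sub,
      map_smul, map_smul, mul_sub, mul_sub, h2, sub_mul, d_apply, smul_add]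
    simp only [mul_smul_comm, smul_mul_assoc]
    abel

/-- The values of `[P, ·]` on functions and on sections, for `P` of degree `p`:
`[P, f] = (-1)^(p-1) i_{df} P` and `[P, Y] = - L_Y P`. -/
def schoutenData {p : ℕ} (P : ⋀[R]^p L) :
    TwistedDerivationData (gradeSign (p + 1) : ExteriorAlgebra R L →ₐ[R] ExteriorAlgebra R L) where
  onScalar :=
    { toFun := fun f => (-1 : R) ^ (p + 1) • contract (B.d f) (P : ExteriorAlgebra R L)
      map_zero' := by simp only [d_zero, map_zero, LinearMap.zero_apply, smul_zero]
      map_add' := fun f g => by simp only [d_add, map_add, LinearMap.add_apply, smul_add] }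
  onVector :=
    { toFun := fun Y => -B.lieDeriv Y (P : ExteriorAlgebra R L)
      map_zero' := by
        have h := B.lieDeriv_add 0 0 (P : ExteriorAlgebra R L)
        rw [add_zero, left_eq_add] at h
        rw [h, neg_zero]
      map_add' := fun X Y => by rw [lieDeriv_add, neg_add] }
  onScalar_mul f g := by
    simp only [AddMonoidHom.coe_mk, ZeroHom.coe_mk, d_mul, map_add, map_smul,
      LinearMap.add_apply, LinearMap.smul_apply, smul_add]
    rw [← Algebra.commutes g, ← Algebra.smul_def, ← Algebra.smul_def, smul_comm f, smul_comm g]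
  onScalar_comm f a := by
    simp only [AddMonoidHom.coe_mk, ZeroHom.coe_mk, smul_mul_assoc, mul_smul_comm]
    congr 1
    rcases p with _ | p
    · rw [contract_of_degree_zero _ P.2, zero_mul, mul_zero]
    · rw [gradeSign_add_two]
      exact mul_comm_of_mem p (contract_mem _ p P.2) a
  onVector_smul f Y := by
    simp only [AddMonoidHom.coe_mk, ZeroHom.coe_mk, lieDeriv_smul, neg_sub, smul_neg]
    rw [sub_eq_neg_add, smul_mul_assoc, add_right_inj, vector_mul_comm]
    rcases p with _ | p
    · rw [contract_of_degree_zero _ P.2, map_zero, zero_mul, smul_zero]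
    · rw [gradeSign_of_mem 1 p (contract_mem _ p P.2), one_mul, smul_mul_assoc, pow_add _ p 2,
        neg_one_sq, mul_one]
  onVector_sq Y := by
    simp only [AddMonoidHom.coe_mk, ZeroHom.coe_mk, neg_mul, mul_neg]
    rw [mul_comm_of_mem p (B.lieDeriv_mem Y p P.2), gradeSign_ι, gradeSign_ι, pow_succ]
    simp

/-- The Schouten bracket `[P, ·]` with a `p`-vector `P`: the additive map of the exterior algebra
determined by `[P, f] = (-1)^(p-1) i_{df} P`, `[P, Y] = - L_Y P` and
`[P, Q ∧ R] = [P, Q] ∧ R + (-1)^((p-1) q) Q ∧ [P, R]` for `Q` of degree `q`. -/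
def schouten {p : ℕ} (P : ⋀[R]^p L) : ExteriorAlgebra R L →+ ExteriorAlgebra R L :=
  (B.schoutenData P).toAddHom

theorem schouten_function {p : ℕ} (P : ⋀[R]^p L) (f : R) :
    B.schouten P (algebraMap R _ f) =
      (-1 : R) ^ (p + 1) • contract (B.d f) (P : ExteriorAlgebra R L) :=
  TwistedDerivationData.toAddHom_algebraMap _ f

theorem schouten_vector {p : ℕ} (P : ⋀[R]^p L) (Y : L) :
    B.schouten P (ι R Y) = -B.lieDeriv Y (P : ExteriorAlgebra R L) :=
  TwistedDerivationData.toAddHom_ι _ Y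

theorem schouten_mul {p q : ℕ} (P : ⋀[R]^p L) (Q : ⋀[R]^q L) (S : ExteriorAlgebra R L) :
    B.schouten P ((Q : ExteriorAlgebra R L) * S) =
      B.schouten P (Q : ExteriorAlgebra R L) * S +
        (-1 : R) ^ ((p + 1) * q) • ((Q : ExteriorAlgebra R L) * B.schouten P S) := by
  rw [schouten, TwistedDerivationData.toAddHom_mul, gradeSign_of_mem _ q Q.2, smul_mul_assoc,
    add_comm]

end LeibnizBracket



namespace LeibnizBracket

open ExteriorAlgebra

variable {k R L : Type*} [CommRing k] [CommRing R] [Algebra k R] [AddCommGroup L]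
    [Module R L] [Module k L] (B : LeibnizBracket k R L)

/-- The Schouten-Jacobi bracket of a `p`-vector `P` and a `q`-vector `Q`,
`[P, Q]^φ = [P, Q] + (p - 1) P ∧ i_φ Q - (-1)^(p - 1) (q - 1) i_φ P ∧ Q`. -/
def schoutenJacobi (φ : Module.Dual R L) {p q : ℕ} (P : ⋀[R]^p L) (Q : ⋀[R]^q L) :
    ExteriorAlgebra R L :=
  B.schouten P Q + ((p : ℤ) - 1) • ((P : ExteriorAlgebra R L) * contract φ Q)
    - ((-1 : ℤ) ^ (p + 1) * ((q : ℤ) - 1)) • (contract φ P * (Q : ExteriorAlgebra R L))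

end LeibnizBracket

namespace ExteriorAlgebra

variable {R L : Type*} [CommRing R] [AddCommGroup L] [Module R L]

/-- An element of `L` as a vector of degree one. -/
def ofVector (X : L) : ⋀[R]^1 L := ⟨ι R X, mem_degree_one.2 ⟨X, rfl⟩⟩

/-- The map `P^♯` of a bivector: `P^♯ α = i_α P`, that is `⟨β, P^♯ α⟩ = P (α, β)`. -/
def sharp (P : ⋀[R]^2 L) (α : Module.Dual R L) : L :=
  ιInv (contract α (P : ExteriorAlgebra R L))

theorem ι_sharp (P : ⋀[R]^2 L) (α : Module.Dual R L) :
    ι R (sharp P α) = contract α (P : ExteriorAlgebra R L) := by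
  obtain ⟨X, hX⟩ := mem_degree_one.1 (contract_mem α 1 P.2)
  rw [sharp, ← hX, ι_leftInverse X]

end ExteriorAlgebra

section Sections

variable {E : Type*} [NormedAddCommGroup E] [NormedSpace ℝ E]
  {H : Type*} [TopologicalSpace H] {I : ModelWithCorners ℝ E H}
  {M : Type*} [TopologicalSpace M] [ChartedSpace H M]
  {F : Type*} [NormedAddCommGroup F] [NormedSpace ℝ F]
  {A : M → Type*} [TopologicalSpace (Bundle.TotalSpace F A)]
  [∀ x, TopologicalSpace (A x)] [FiberBundle F A]
  [∀ x, AddCommGroup (A x)] [∀ x, Module ℝ (A x)] [VectorBundle ℝ F A]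

/-- Smooth sections of a vector bundle form a module over the smooth functions. -/
instance ContMDiffSection.instModuleSmoothFunctions :
    Module C^∞⟮I, M; ℝ⟯ Cₛ^∞⟮I; F, A⟯ where
  smul f X := ⟨fun x => f x • X x, f.contMDiff.smul_section X.contMDiff⟩
  one_smul X := ContMDiffSection.ext fun x => one_smul ℝ (X x)
  mul_smul f g X := ContMDiffSection.ext fun x => mul_smul (f x) (g x) (X x)
  smul_zero f := ContMDiffSection.ext fun x => smul_zero (f x)
  smul_add f X Y := ContMDiffSection.ext fun x => smul_add (f x) (X x) (Y x)
  add_smul f g X := ContMDiffSection.ext fun x => add_smul (f x) (g x) (X x)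
  zero_smul X := ContMDiffSection.ext fun x => zero_smul ℝ (X x)

theorem ContMDiffSection.smooth_smul_apply (f : C^∞⟮I, M; ℝ⟯) (X : Cₛ^∞⟮I; F, A⟯) (x : M) :
    (f • X) x = f x • X x := rfl

variable {F' : Type*} [NormedAddCommGroup F'] [NormedSpace ℝ F']
  {A' : M → Type*} [TopologicalSpace (Bundle.TotalSpace F' A')]
  [∀ x, TopologicalSpace (A' x)] [FiberBundle F' A']
  [∀ x, AddCommGroup (A' x)] [∀ x, Module ℝ (A' x)] [VectorBundle ℝ F' A']
  [∀ x, IsTopologicalAddGroup (A' x)] [∀ x, ContinuousSMul ℝ (A' x)]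

/-- The map on sections induced by a smooth vector bundle morphism over the identity. -/
def ContMDiffSection.bundleMap (ρ : Cₛ^∞⟮I; F →L[ℝ] F', fun x => A x →L[ℝ] A' x⟯) :
    Cₛ^∞⟮I; F, A⟯ →ₗ[C^∞⟮I, M; ℝ⟯] Cₛ^∞⟮I; F', A'⟯ where
  toFun X := ⟨fun x => ρ x (X x), ρ.contMDiff.clm_bundle_apply X.contMDiff⟩
  map_add' X Y := ContMDiffSection.ext fun x => map_add (ρ x) (X x) (Y x)
  map_smul' f X := ContMDiffSection.ext fun x => map_smul (ρ x) (f x) (X x)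

theorem ContMDiffSection.bundleMap_apply
    (ρ : Cₛ^∞⟮I; F →L[ℝ] F', fun x => A x →L[ℝ] A' x⟯) (X : Cₛ^∞⟮I; F, A⟯) (x : M) :
    ContMDiffSection.bundleMap ρ X x = ρ x (X x) := rfl

/-- The `C^∞(M)`-linear functional on sections given by a smooth section of the dual bundle. -/
def ContMDiffSection.toDual
    (φ : Cₛ^∞⟮I; F →L[ℝ] ℝ, fun x => A x →L[ℝ] Bundle.Trivial M ℝ x⟯) :
    Module.Dual C^∞⟮I, M; ℝ⟯ Cₛ^∞⟮I; F, A⟯ where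
  toFun X := ⟨fun x => φ x (X x), fun x =>
    ((Bundle.contMDiffAt_section _).1 ((ContMDiffSection.bundleMap φ X).contMDiff x))⟩
  map_add' X Y := ContMDiffMap.ext fun x => map_add (φ x) (X x) (Y x)
  map_smul' f X := ContMDiffMap.ext fun x => map_smul (φ x) (f x) (X x)

theorem ContMDiffSection.toDual_apply
    (φ : Cₛ^∞⟮I; F →L[ℝ] ℝ, fun x => A x →L[ℝ] Bundle.Trivial M ℝ x⟯) (X : Cₛ^∞⟮I; F, A⟯)
    (x : M) : ContMDiffSection.toDual φ X x = φ x (X x) := rfl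

end Sections

section VectorFields

variable {E : Type*} [NormedAddCommGroup E] [NormedSpace ℝ E]
  {H : Type*} [TopologicalSpace H] (I : ModelWithCorners ℝ E H)
  (M : Type*) [TopologicalSpace M] [ChartedSpace H M] [IsManifold I ∞ M]

/-- Smooth vector fields. -/
abbrev SmoothVectorField : Type _ := Cₛ^∞⟮I; E, (TangentSpace I : M → Type _)⟯

variable {I M}

/-- The directional derivative of a smooth function along a smooth vector field. -/
def SmoothVectorField.deriv (X : SmoothVectorField I M) (f : C^∞⟮I, M; ℝ⟯) : C^∞⟮I, M; ℝ⟯ :=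
  ⟨fun x => mvfderiv I f x (X x), by
    have h1 : ContMDiff I.tangent 𝓘(ℝ, ℝ).tangent ∞ (tangentMap I 𝓘(ℝ, ℝ) f) :=
      f.contMDiff.contMDiff_tangentMap le_rfl
    have h2 := (contMDiff_snd_tangentBundle_modelSpace ℝ 𝓘(ℝ, ℝ) (n := ∞)).comp
      (h1.comp X.contMDiff)
    exact h2⟩

theorem SmoothVectorField.deriv_apply (X : SmoothVectorField I M) (f : C^∞⟮I, M; ℝ⟯) (x : M) :
    X.deriv f x = mvfderiv I f x (X x) := rfl

/-- Smooth vector fields act on smooth functions as derivations. -/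
def SmoothVectorField.toDerivation :
    SmoothVectorField I M →ₗ[C^∞⟮I, M; ℝ⟯] Derivation ℝ C^∞⟮I, M; ℝ⟯ C^∞⟮I, M; ℝ⟯ where
  toFun X := Derivation.mk'
    { toFun := X.deriv
      map_add' := fun f g => by
        ext x
        change mvfderiv I (f + g : M → ℝ) x (X x) = _
        rw [mvfderiv_add f.mdifferentiableAt g.mdifferentiableAt]
        rfl
      map_smul' := fun c f => by
        ext x
        change mvfderiv I (fun y => c * f y) x (X x) = c * mvfderiv I f x (X x)
        have h := mvfderiv_mul (I := I) (f := fun _ : M => c) (g := f) (x := x)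
          mdifferentiableAt_const f.mdifferentiableAt
        rw [mvfderiv_const, smul_zero, add_zero] at h
        exact congrArg (fun T => T (X x)) h }
    (fun f g => by
      ext x
      have h := mvfderiv_mul (I := I) (f := f) (g := g) (x := x)
        f.mdifferentiableAt g.mdifferentiableAt
      exact congrArg (fun T => T (X x)) h)
  map_add' X Y := by
    ext f x
    exact map_add (mvfderiv I f x) (X x) (Y x)
  map_smul' g X := by
    ext f x
    exact map_smul (mvfderiv I f x) (g x) (X x)

theorem SmoothVectorField.toDerivation_apply (X : SmoothVectorField I M) (f : C^∞⟮I, M; ℝ⟯)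
    (x : M) : SmoothVectorField.toDerivation X f x = mvfderiv I f x (X x) := rfl

variable [FiniteDimensional ℝ E]

/-- The Lie bracket of smooth vector fields. -/
def SmoothVectorField.lieBracket (X Y : SmoothVectorField I M) : SmoothVectorField I M :=
  ⟨VectorField.mlieBracket I X Y, fun x => by
    have := FiniteDimensional.complete ℝ E
    have : IsManifold I ((∞ : ℕ∞ω) + 1) M := inferInstanceAs (IsManifold I ∞ M)
    have : IsManifold I (minSmoothness ℝ 3) M := by
      rw [minSmoothness_of_isRCLikeNormedField]; infer_instance
    exact ContMDiffAt.mlieBracket_vectorField (m := ⊤) (n := ⊤) (X.contMDiff x) (Y.contMDiff x)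
      (by rw [minSmoothness_of_isRCLikeNormedField]; exact le_rfl)⟩

theorem SmoothVectorField.lieBracket_apply (X Y : SmoothVectorField I M) (x : M) :
    X.lieBracket Y x = VectorField.mlieBracket I X Y x := rfl

variable (I M) in
/-- The Lie bracket of vector fields and their action on functions. -/
def vectorFieldBracket :
    LeibnizBracket ℝ C^∞⟮I, M; ℝ⟯ (SmoothVectorField I M) where
  bracket := LinearMap.mk₂ ℝ SmoothVectorField.lieBracket
    (fun X Y Z => ContMDiffSection.ext fun x => by
      have := FiniteDimensional.complete ℝ E
      exact VectorField.mlieBracket_add_left X.mdifferentiableAt Y.mdifferentiableAt)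
    (fun c X Y => ContMDiffSection.ext fun x => by
      have := FiniteDimensional.complete ℝ E
      exact VectorField.mlieBracket_const_smul_left X.mdifferentiableAt)
    (fun X Y Z => ContMDiffSection.ext fun x => by
      have := FiniteDimensional.complete ℝ E
      exact VectorField.mlieBracket_add_right Y.mdifferentiableAt Z.mdifferentiableAt)
    (fun c X Y => ContMDiffSection.ext fun x => by
      have := FiniteDimensional.complete ℝ E
      exact VectorField.mlieBracket_const_smul_right Y.mdifferentiableAt)
  act := SmoothVectorField.toDerivation
  bracket_self X := ContMDiffSection.ext fun x =>
    congrFun (VectorField.mlieBracket_self (I := I) (V := (X : ∀ x, TangentSpace I x))) x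
  leibniz X Y f := ContMDiffSection.ext fun x => by
    have := FiniteDimensional.complete ℝ E
    have h := VectorField.mlieBracket_smul_right (V := (X : ∀ x, TangentSpace I x))
      (f := f) (x := x) f.mdifferentiableAt Y.mdifferentiableAt
    rw [add_comm] at h
    exact h

/-- A Jacobi structure `(Λ, E)` on a manifold: a bivector field `Λ` and a vector field `E` with
`[Λ, Λ] = -2 E ∧ Λ` and `[E, Λ] = 0`. -/
def IsJacobiStructure (Λ : ⋀[C^∞⟮I, M; ℝ⟯]^2 (SmoothVectorField I M))
    (E₀ : SmoothVectorField I M) : Prop :=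
  (vectorFieldBracket I M).schouten Λ Λ =
      (-2 : ℤ) • (ExteriorAlgebra.ι C^∞⟮I, M; ℝ⟯ E₀ *
        (Λ : ExteriorAlgebra C^∞⟮I, M; ℝ⟯ (SmoothVectorField I M))) ∧
    (vectorFieldBracket I M).schouten (ExteriorAlgebra.ofVector E₀) Λ = 0

/-- Two Jacobi structures are compatible if their sum is a Jacobi structure. -/
def AreCompatibleJacobiStructures
    (Λ₁ : ⋀[C^∞⟮I, M; ℝ⟯]^2 (SmoothVectorField I M)) (E₁ : SmoothVectorField I M)
    (Λ₂ : ⋀[C^∞⟮I, M; ℝ⟯]^2 (SmoothVectorField I M)) (E₂ : SmoothVectorField I M) : Prop :=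
  IsJacobiStructure Λ₁ E₁ ∧ IsJacobiStructure Λ₂ E₂ ∧ IsJacobiStructure (Λ₁ + Λ₂) (E₁ + E₂)

end VectorFields

section Algebroids

variable {E : Type*} [NormedAddCommGroup E] [NormedSpace ℝ E] [FiniteDimensional ℝ E]
  {H : Type*} [TopologicalSpace H] (I : ModelWithCorners ℝ E H)
  {M : Type*} [TopologicalSpace M] [ChartedSpace H M] [IsManifold I ∞ M]
  (F : Type*) [NormedAddCommGroup F] [NormedSpace ℝ F]
  (A : M → Type*) [TopologicalSpace (Bundle.TotalSpace F A)]
  [∀ x, TopologicalSpace (A x)] [FiberBundle F A]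
  [∀ x, AddCommGroup (A x)] [∀ x, Module ℝ (A x)] [VectorBundle ℝ F A]

/-- A Lie algebroid structure on the vector bundle `A` over `M`: a smooth bundle map
`anchor : A → TM` and a Lie bracket on the smooth sections of `A` with the Leibniz rule, such that
the anchor preserves brackets. -/
structure LieAlgebroid where
  anchor : Cₛ^∞⟮I; F →L[ℝ] E, fun x : M => A x →L[ℝ] TangentSpace I x⟯
  bracket : Cₛ^∞⟮I; F, A⟯ →ₗ[ℝ] Cₛ^∞⟮I; F, A⟯ →ₗ[ℝ] Cₛ^∞⟮I; F, A⟯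
  bracket_self : ∀ X, bracket X X = 0
  jacobi : ∀ X Y Z,
    bracket X (bracket Y Z) = bracket (bracket X Y) Z + bracket Y (bracket X Z)
  leibniz : ∀ (X Y : Cₛ^∞⟮I; F, A⟯) (f : C^∞⟮I, M; ℝ⟯), bracket X (f • Y) =
    f • bracket X Y + SmoothVectorField.deriv (ContMDiffSection.bundleMap anchor X) f • Y
  anchor_bracket : ∀ X Y, ContMDiffSection.bundleMap anchor (bracket X Y) =
    SmoothVectorField.lieBracket (ContMDiffSection.bundleMap anchor X)
      (ContMDiffSection.bundleMap anchor Y)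

/-- A Jacobi algebroid: a Lie algebroid together with a section `φ₀` of `A*` with `d φ₀ = 0`, where
`d φ₀ (X, Y) = ρ(X) ⟨φ₀, Y⟩ - ρ(Y) ⟨φ₀, X⟩ - ⟨φ₀, [X, Y]⟩`. -/
structure JacobiAlgebroid extends LieAlgebroid I F A where
  φ₀ : Cₛ^∞⟮I; F →L[ℝ] ℝ, fun x : M => A x →L[ℝ] Bundle.Trivial M ℝ x⟯
  closed : ∀ X Y : Cₛ^∞⟮I; F, A⟯,
    SmoothVectorField.deriv (ContMDiffSection.bundleMap anchor X) (ContMDiffSection.toDual φ₀ Y)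
      - SmoothVectorField.deriv (ContMDiffSection.bundleMap anchor Y)
        (ContMDiffSection.toDual φ₀ X)
      - ContMDiffSection.toDual φ₀ (bracket X Y) = 0

variable {I F A}

/-- The anchor as a `C^∞(M)`-linear map from sections of `A` to vector fields. -/
def LieAlgebroid.ρ (𝒜 : LieAlgebroid I F A) :
    Cₛ^∞⟮I; F, A⟯ →ₗ[C^∞⟮I, M; ℝ⟯] SmoothVectorField I M :=
  ContMDiffSection.bundleMap 𝒜.anchor

/-- The bracket of sections of `A` and their action on functions through the anchor. -/
def LieAlgebroid.leibnizBracket (𝒜 : LieAlgebroid I F A) :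
    LeibnizBracket ℝ C^∞⟮I, M; ℝ⟯ Cₛ^∞⟮I; F, A⟯ where
  bracket := 𝒜.bracket
  act := SmoothVectorField.toDerivation ∘ₗ 𝒜.ρ
  bracket_self := 𝒜.bracket_self
  leibniz := 𝒜.leibniz

variable (I F A) in
/-- The module `𝔛^p(A)` of `A`-`p`-vector fields, as the `p`-th exterior power over `C^∞(M)` of the
module of smooth sections of `A`; this is the module of smooth sections of the bundle `⋀^p A`. -/
abbrev AMultivector (p : ℕ) : Type _ := ⋀[C^∞⟮I, M; ℝ⟯]^p Cₛ^∞⟮I; F, A⟯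

/-- The morphism `ρ^p : 𝔛^p(A) → 𝔛^p(M)`. -/
def LieAlgebroid.ρPow (𝒜 : LieAlgebroid I F A) (p : ℕ) :
    AMultivector I F A p →ₗ[C^∞⟮I, M; ℝ⟯] ⋀[C^∞⟮I, M; ℝ⟯]^p (SmoothVectorField I M) :=
  exteriorPower.map p 𝒜.ρ

namespace JacobiAlgebroid

variable (𝒜 : JacobiAlgebroid I F A)

/-- `φ₀` as a `C^∞(M)`-linear functional on sections. -/
def φ : Module.Dual C^∞⟮I, M; ℝ⟯ Cₛ^∞⟮I; F, A⟯ := ContMDiffSection.toDual 𝒜.φ₀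

/-- The Schouten-Jacobi bracket `[P, Q]^{φ₀}` of the Jacobi algebroid. -/
def schoutenJacobi {p q : ℕ} (P : AMultivector I F A p) (Q : AMultivector I F A q) :
    ExteriorAlgebra C^∞⟮I, M; ℝ⟯ Cₛ^∞⟮I; F, A⟯ :=
  𝒜.toLieAlgebroid.leibnizBracket.schoutenJacobi 𝒜.φ P Q

/-- A Jacobi bivector: `[P, P]^{φ₀} = 0`. -/
def IsJacobiBivector (P : AMultivector I F A 2) : Prop := 𝒜.schoutenJacobi P P = 0

/-- Compatible Jacobi bivectors: Jacobi bivectors with `[P₁, P₂]^{φ₀} = 0`. -/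
def AreCompatible (P₁ P₂ : AMultivector I F A 2) : Prop :=
  𝒜.IsJacobiBivector P₁ ∧ 𝒜.IsJacobiBivector P₂ ∧ 𝒜.schoutenJacobi P₁ P₂ = 0

/-- The bivector field `ρ² P` on the base. -/
def inducedBivector (P : AMultivector I F A 2) :
    ⋀[C^∞⟮I, M; ℝ⟯]^2 (SmoothVectorField I M) :=
  𝒜.ρPow 2 P

/-- The vector field `ρ (P^♯ φ₀)` on the base. -/
def inducedVectorField (P : AMultivector I F A 2) : SmoothVectorField I M :=
  𝒜.ρ (ExteriorAlgebra.sharp P 𝒜.φ)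

end JacobiAlgebroid

end Algebroids
end

/-!
Write `φ` for the closed one-form `φ₀` and `ξ = P^♯ φ` for a bivector `P`. For bivectors the
Schouten-Jacobi bracket is `[P, Q]^φ = [P, Q] + Q^♯φ ∧ P + P^♯φ ∧ Q`, so `[P, P]^φ = 0` says
`[P, P] = -2 ξ ∧ P` already on the algebroid.

The second Jacobi equation `L_ξ P = 0` follows by contracting the first with `φ`. Since `φ` is
closed, `i_φ` is a derivation of the Schouten bracket: `i_φ [P, Q] + [P, i_φ Q] = L_ξ Q`
(`LeibnizBracket.contract_schouten_add`). At `Q = P` this is `i_φ [P, P] = 2 L_ξ P`, while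
`i_φ (ξ ∧ P) = ⟨φ, ξ⟩ P - ξ ∧ ξ = 0`.

The anchor is `C^∞(M)`-linear and preserves brackets and the action on functions, so the induced map
of exterior algebras carries Schouten brackets to Schouten brackets
(`LeibnizBracket.map_schouten`), and both equations descend to the base. Compatibility needs nothing
further: the bracket of bivectors is symmetric (`LeibnizBracket.schouten_comm`), so `P₁ + P₂` is
again a Jacobi bivector, and `P ↦ (ρ² P, ρ (P^♯ φ))` is additive.
-/

/-! ### Contractions and functoriality of the exterior algebra -/

namespace ExteriorAlgebra

variable {R L L' : Type*} [CommRing R] [AddCommGroup L] [Module R L] [AddCommGroup L'] [Module R L']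

/-- The interior product by a one-form is an antiderivation. -/
theorem contract_mul (α : Module.Dual R L) (a b : ExteriorAlgebra R L) :
    contract α (a * b) = contract α a * b + gradeSign 1 a * contract α b := by
  induction a using ExteriorAlgebra.induction generalizing b with
  | algebraMap f =>
    rw [contract_algebraMap, zero_mul, zero_add, AlgHom.commutes, ← Algebra.smul_def,
      ← Algebra.smul_def, map_smul]
  | ι X =>
    rw [contract_ι_mul, contract_ι, gradeSign_ι, pow_one, neg_one_smul, neg_mul, Algebra.smul_def,
      sub_eq_add_neg]
  | mul a a' ha ha' =>
    rw [mul_assoc, ha, ha', ha, map_mul, mul_add, add_mul]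
    simp only [mul_assoc, add_assoc]
  | add a a' ha ha' => rw [add_mul, map_add, ha, ha', map_add, map_add, add_mul, add_mul]; abel

theorem contract_map (f : L →ₗ[R] L') (α : Module.Dual R L') (P : ExteriorAlgebra R L) :
    contract α (map f P) = map f (contract (α ∘ₗ f) P) := by
  induction P using CliffordAlgebra.left_induction with
  | algebraMap g =>
    change contract α (map f (algebraMap R (ExteriorAlgebra R L) g)) =
      map f (contract (α ∘ₗ f) (algebraMap R (ExteriorAlgebra R L) g))
    rw [AlgHom.commutes, contract_algebraMap, contract_algebraMap, map_zero]
  | add a b ha hb => simp only [map_add] at ha hb ⊢; rw [ha, hb]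
  | ι_mul P X hP =>
    change contract α (map f (ι R X * P)) = map f (contract (α ∘ₗ f) (ι R X * P))
    rw [map_mul, map_apply_ι, contract_ι_mul, contract_ι_mul, hP, map_sub, map_smul, map_mul,
      map_apply_ι, LinearMap.comp_apply]

theorem gradeSign_map (f : L →ₗ[R] L') (k : ℕ) (P : ExteriorAlgebra R L) :
    gradeSign k (map f P) = map f (gradeSign k P) := by
  induction P using ExteriorAlgebra.induction with
  | algebraMap g => simp only [AlgHom.commutes]
  | ι X => simp only [map_apply_ι, gradeSign_ι, map_smul]
  | mul a b ha hb => simp only [map_mul, ha, hb]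
  | add a b ha hb => simp only [map_add, ha, hb]

theorem coe_exteriorPower_map (f : L →ₗ[R] L') (p : ℕ) (P : ⋀[R]^p L) :
    (exteriorPower.map p f P : ExteriorAlgebra R L') = map f (P : ExteriorAlgebra R L) := by
  have h : (⋀[R]^p L').subtype ∘ₗ exteriorPower.map p f =
      (map f).toLinearMap ∘ₗ (⋀[R]^p L).subtype := by
    ext v
    simp [exteriorPower.ιMulti_apply_coe, ιMulti_apply, Function.comp_def, map_list_prod,
      List.map_ofFn]
  exact LinearMap.congr_fun h P

theorem sharp_add (P Q : ⋀[R]^2 L) (α : Module.Dual R L) :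
    sharp (P + Q) α = sharp P α + sharp Q α := by
  simp only [sharp, Submodule.coe_add, map_add]

/-- Since `P` is alternating, `⟨α, P^♯ α⟩ = P (α, α) = 0`. -/
theorem apply_sharp_self (P : ⋀[R]^2 L) (α : Module.Dual R L) : α (sharp P α) = 0 := by
  have h : contract α (contract α (P : ExteriorAlgebra R L)) = 0 :=
    CliffordAlgebra.contractLeft_contractLeft _ _
  rw [← ι_sharp, contract_ι] at h
  exact (algebraMap_eq_zero_iff L _).1 h

theorem contract_anticomm (α β : Module.Dual R L) (P : ExteriorAlgebra R L) :
    contract α (contract β P) = -contract β (contract α P) :=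
  CliffordAlgebra.contractLeft_comm _ _ _

/-- Vectors commute with even elements, in particular with bivectors. -/
theorem vector_mul_comm_of_mem_two (X : L) {P : ExteriorAlgebra R L} (hP : P ∈ ⋀[R]^2 L) :
    ι R X * P = P * ι R X := by
  rw [vector_mul_comm, gradeSign_of_mem 1 2 hP]
  simp

end ExteriorAlgebra

namespace LeibnizBracket

open ExteriorAlgebra

variable {k R L L' : Type*} [CommRing k] [CommRing R] [Algebra k R] [AddCommGroup L]
    [Module R L] [Module k L] [AddCommGroup L'] [Module R L'] [Module k L']
    (B : LeibnizBracket k R L) (B' : LeibnizBracket k R L')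

/-! ### The Schouten bracket of bivectors -/

theorem schouten_mul_gradeSign {p : ℕ} (P : ⋀[R]^p L) (a b : ExteriorAlgebra R L) :
    B.schouten P (a * b) = gradeSign (p + 1) a * B.schouten P b + B.schouten P a * b :=
  TwistedDerivationData.toAddHom_mul _ a b

theorem schouten_ofVector (X : L) (Q : ExteriorAlgebra R L) :
    B.schouten (ofVector X) Q = B.lieDeriv X Q := by
  induction Q using ExteriorAlgebra.induction with
  | algebraMap f =>
    rw [schouten_function, lieDeriv_algebraMap]
    change (-1 : R) ^ 2 • contract (B.d f) (ι R X) = _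
    rw [contract_ι, neg_one_sq, one_smul, d_apply]
  | ι Y =>
    rw [schouten_vector, lieDeriv_ι]
    change -B.lieDeriv Y (ι R X) = _
    rw [lieDeriv_ι, B.bracket_swap Y X, map_neg, neg_neg]
  | mul a b ha hb =>
    have h : (gradeSign (1 + 1) : ExteriorAlgebra R L →ₐ[R] ExteriorAlgebra R L) a = a := by
      rw [show 1 + 1 = 0 + 2 from rfl, gradeSign_add_two]; simp [gradeSign]
    rw [schouten_mul_gradeSign, lieDeriv_mul, ha, hb, h]
  | add a b ha hb => rw [map_add, map_add, ha, hb]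

theorem schouten_add_left {p : ℕ} (P P' : ⋀[R]^p L) (Q : ExteriorAlgebra R L) :
    B.schouten (P + P') Q = B.schouten P Q + B.schouten P' Q := by
  induction Q using ExteriorAlgebra.induction with
  | algebraMap f => simp only [schouten_function, Submodule.coe_add, map_add, smul_add]
  | ι Y => simp only [schouten_vector, Submodule.coe_add, map_add, neg_add]
  | mul a b ha hb => simp only [schouten_mul_gradeSign, ha, hb, mul_add, add_mul]; abel
  | add a b ha hb => simp only [map_add, ha, hb]; abel

/-- The Schouten bracket with a decomposable bivector. The right-hand side obeys the same twisted
Leibniz rule in `Q`, so only functions and vectors need to be compared. -/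
theorem schouten_ι_mul_ι (Y Z : L) (P : ⋀[R]^2 L)
    (hP : (P : ExteriorAlgebra R L) = ι R Y * ι R Z) (Q : ExteriorAlgebra R L) :
    B.schouten P Q = ι R Y * B.lieDeriv Z Q - ι R Z * B.lieDeriv Y Q := by
  induction Q using ExteriorAlgebra.induction with
  | algebraMap f =>
    rw [schouten_function, hP, contract_ι_mul, contract_ι, lieDeriv_algebraMap,
      lieDeriv_algebraMap, d_apply, d_apply, show (-1 : R) ^ (2 + 1) = -1 by ring, neg_one_smul,
      neg_sub, Algebra.smul_def, Algebra.commutes (B.act Y f)]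
  | ι W =>
    rw [schouten_vector, hP, lieDeriv_mul, lieDeriv_ι, lieDeriv_ι, lieDeriv_ι, lieDeriv_ι,
      B.bracket_swap W Z, B.bracket_swap W Y, map_neg, map_neg, mul_neg, neg_mul,
      eq_neg_of_add_eq_zero_left (ι_add_mul_swap (B.bracket Y W) Z)]
    abel
  | mul a b ha hb =>
    have h (X : L) (c : ExteriorAlgebra R L) : gradeSign 1 a * (ι R X * c) = ι R X * (a * c) := by
      rw [← mul_assoc, ← vector_mul_comm, mul_assoc]
    rw [schouten_mul_gradeSign, gradeSign_add_two 1, ha, hb, lieDeriv_mul, lieDeriv_mul, mul_sub,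
      h, h, sub_mul, mul_add, mul_add, mul_assoc, mul_assoc]
    abel
  | add a b ha hb => rw [map_add, ha, hb, map_add, map_add, mul_add, mul_add]; abel

theorem schouten_comm_of_decomposable (P Q : ⋀[R]^2 L) (Y Z : L)
    (hQ : (Q : ExteriorAlgebra R L) = ι R Y * ι R Z) : B.schouten P Q = B.schouten Q P := by
  have h : (-1 : R) ^ (2 + 1) = -1 := by ring
  rw [schouten_ι_mul_ι B Y Z Q hQ, hQ, schouten_mul_gradeSign, gradeSign_ι, schouten_vector,
    schouten_vector, h, neg_one_smul, neg_mul_neg, neg_mul,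
    vector_mul_comm_of_mem_two Z (B.lieDeriv_mem Y 2 P.2), sub_eq_add_neg]

/-- The Schouten bracket of bivectors is symmetric. -/
theorem schouten_comm (P Q : ⋀[R]^2 L) : B.schouten P Q = B.schouten Q P := by
  obtain ⟨Q, hQ⟩ := Q
  have hQ' := hQ
  rw [degree_succ] at hQ'
  induction hQ' using Submodule.mul_induction_on' with
  | mem_mul_mem m hm n hn =>
    obtain ⟨Y, rfl⟩ := hm
    obtain ⟨Z, rfl⟩ := mem_degree_one.1 hn
    exact B.schouten_comm_of_decomposable P _ Y Z rfl
  | add x hx y hy ihx ihy =>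
    rw [← degree_succ] at hx hy
    have h := B.schouten_add_left ⟨x, hx⟩ ⟨y, hy⟩ (P : ExteriorAlgebra R L)
    rw [← ihx hx, ← ihy hy] at h
    exact (map_add (B.schouten P) x y).trans h.symm

/-! ### Contraction with a closed one-form -/

/-- Cartan's formula `i_φ L_Y = L_Y i_φ - i_{L_Y φ}`, where `L_Y φ = d ⟨φ, Y⟩` because `φ` is
closed. -/
theorem contract_lieDeriv {φ : Module.Dual R L}
    (hφ : ∀ X Y, B.act X (φ Y) - B.act Y (φ X) - φ (B.bracket X Y) = 0) (Y : L)
    (P : ExteriorAlgebra R L) :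
    contract φ (B.lieDeriv Y P) = B.lieDeriv Y (contract φ P) - contract (B.d (φ Y)) P := by
  induction P using ExteriorAlgebra.induction with
  | algebraMap f => simp only [lieDeriv_algebraMap, contract_algebraMap, map_zero, sub_zero]
  | ι X =>
    simp only [lieDeriv_ι, contract_ι, lieDeriv_algebraMap, d_apply, ← map_sub]
    rw [← sub_eq_zero.1 (hφ Y X)]
  | mul a b ha hb =>
    have h (c : ExteriorAlgebra R L) :
        B.lieDeriv Y (gradeSign 1 c) = gradeSign 1 (B.lieDeriv Y c) := by
      induction c using ExteriorAlgebra.induction with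
      | algebraMap f => simp only [lieDeriv_algebraMap, AlgHom.commutes]
      | ι X => simp only [lieDeriv_ι, gradeSign_ι, pow_one, neg_one_smul, map_neg]
      | mul a b ha hb => simp only [lieDeriv_mul, map_mul, map_add, ha, hb]
      | add a b ha hb => simp only [map_add, ha, hb]
    simp only [lieDeriv_mul, contract_mul, map_add, ha, hb, h, mul_sub, sub_mul]
    abel
  | add a b ha hb => simp only [map_add, ha, hb]; abel

/-- For closed `φ`, contraction by `φ` is a derivation of the Schouten bracket with a bivector `P`:
`i_φ [P, Q] + [P, i_φ Q] = L_ξ Q` with `ξ = P^♯ φ`. The left-hand side is the anticommutator of two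
antiderivations, hence a derivation in `Q`. -/
theorem contract_schouten_add {φ : Module.Dual R L}
    (hφ : ∀ X Y, B.act X (φ Y) - B.act Y (φ X) - φ (B.bracket X Y) = 0) (P : ⋀[R]^2 L)
    (Q : ExteriorAlgebra R L) :
    contract φ (B.schouten P Q) + B.schouten P (contract φ Q) = B.lieDeriv (sharp P φ) Q := by
  have hs : (-1 : R) ^ (2 + 1) = -1 := by ring
  induction Q using ExteriorAlgebra.induction with
  | algebraMap f =>
    rw [schouten_function, hs, neg_one_smul, map_neg, contract_anticomm, neg_neg, ← ι_sharp,
      contract_ι, contract_algebraMap, map_zero, add_zero, d_apply, lieDeriv_algebraMap]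
  | ι Y =>
    rw [schouten_vector, map_neg, B.contract_lieDeriv hφ, contract_ι, schouten_function, hs,
      neg_one_smul, ← ι_sharp, lieDeriv_ι, lieDeriv_ι, B.bracket_swap Y, map_neg]
    abel
  | mul a b ha hb =>
    have hP (c : ExteriorAlgebra R L) :
        B.schouten P (gradeSign 1 c) = -gradeSign 1 (B.schouten P c) := by
      induction c using ExteriorAlgebra.induction with
      | algebraMap f =>
        rw [AlgHom.commutes, schouten_function, map_smul,
          gradeSign_of_mem 1 1 (contract_mem _ 1 P.2)]
        simp
      | ι X =>
        rw [gradeSign_ι, pow_one, neg_one_smul, map_neg, schouten_vector, map_neg,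
          gradeSign_of_mem 1 2 (B.lieDeriv_mem X 2 P.2)]
        simp
      | mul a b ha hb =>
        simp only [map_mul, schouten_mul_gradeSign, gradeSign_add_two, map_add, ha, hb, mul_neg,
          neg_mul]
        rw [neg_add]
      | add a b ha hb => simp only [map_add, ha, hb, neg_add]
    have hi (c : ExteriorAlgebra R L) :
        contract φ (gradeSign 1 c) = -gradeSign 1 (contract φ c) := by
      induction c using ExteriorAlgebra.induction with
      | algebraMap f => simp only [AlgHom.commutes, contract_algebraMap, map_zero, neg_zero]
      | ι X =>
        rw [gradeSign_ι, pow_one, neg_one_smul, map_neg, contract_ι, AlgHom.commutes]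
      | mul a b ha hb =>
        simp only [map_mul, contract_mul, map_add, ha, hb, mul_neg, neg_mul]
        rw [neg_add]
      | add a b ha hb => simp only [map_add, ha, hb, neg_add]
    have hg (c : ExteriorAlgebra R L) : gradeSign 1 (gradeSign 1 c) = c :=
      CliffordAlgebra.involute_involute c
    simp only [schouten_mul_gradeSign, contract_mul, gradeSign_add_two, map_add, lieDeriv_mul,
      ← ha, ← hb, hP, hi, hg, mul_add, add_mul, neg_mul]
    abel
  | add a b ha hb => simp only [map_add, ← ha, ← hb]; abel

/-! ### Jacobi bivectors -/

theorem schoutenJacobi_bivector (φ : Module.Dual R L) (P Q : ⋀[R]^2 L) :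
    B.schoutenJacobi φ P Q = B.schouten P Q + ι R (sharp Q φ) * (P : ExteriorAlgebra R L) +
      ι R (sharp P φ) * (Q : ExteriorAlgebra R L) := by
  rw [schoutenJacobi, ← ι_sharp, ← ι_sharp, ← vector_mul_comm_of_mem_two _ P.2]
  norm_num

/-- The Schouten-Jacobi bracket of bivectors is symmetric, so the sum of two compatible Jacobi
bivectors is a Jacobi bivector. -/
theorem schoutenJacobi_add_self {φ : Module.Dual R L} {P Q : ⋀[R]^2 L}
    (hP : B.schoutenJacobi φ P P = 0) (hQ : B.schoutenJacobi φ Q Q = 0)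
    (hPQ : B.schoutenJacobi φ P Q = 0) : B.schoutenJacobi φ (P + Q) (P + Q) = 0 := by
  have h : B.schoutenJacobi φ (P + Q) (P + Q) = B.schoutenJacobi φ P P +
      B.schoutenJacobi φ Q Q + (B.schoutenJacobi φ P Q + B.schoutenJacobi φ P Q) := by
    simp only [schoutenJacobi_bivector, sharp_add, schouten_add_left, Submodule.coe_add, map_add,
      mul_add, add_mul, B.schouten_comm Q P]
    abel
  rw [h, hP, hQ, hPQ, add_zero, add_zero]

theorem schouten_self_of_schoutenJacobi_eq_zero {φ : Module.Dual R L} {P : ⋀[R]^2 L}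
    (hP : B.schoutenJacobi φ P P = 0) :
    B.schouten P P = (-2 : ℤ) • (ι R (sharp P φ) * (P : ExteriorAlgebra R L)) := by
  rw [schoutenJacobi_bivector, add_assoc] at hP
  rw [eq_neg_of_add_eq_zero_left hP, neg_smul, two_smul]

/-- Contracting `[P, P] = -2 ξ ∧ P` with `φ` kills the right-hand side, as `⟨φ, ξ⟩ = 0` and
`ξ ∧ ξ = 0`, and gives `2 L_ξ P` on the left. -/
theorem lieDeriv_sharp_of_schoutenJacobi_eq_zero (h2 : IsUnit (2 : R)) {φ : Module.Dual R L}
    (hφ : ∀ X Y, B.act X (φ Y) - B.act Y (φ X) - φ (B.bracket X Y) = 0) {P : ⋀[R]^2 L}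
    (hP : B.schoutenJacobi φ P P = 0) : B.lieDeriv (sharp P φ) (P : ExteriorAlgebra R L) = 0 := by
  have h := B.contract_schouten_add hφ P P
  rw [B.schouten_self_of_schoutenJacobi_eq_zero hP, map_zsmul, contract_ι_mul, apply_sharp_self,
    ← ι_sharp, ι_sq_zero, zero_smul, sub_zero, smul_zero, zero_add, schouten_vector] at h
  refine (h2.smul_eq_zero).1 ?_
  rw [two_smul]
  nth_rewrite 1 [← h]
  exact neg_add_cancel _

/-! ### Morphisms of brackets -/

section Morphism

variable {B B'} {f : L →ₗ[R] L'}

theorem map_lieDeriv (hact : ∀ X, B'.act (f X) = B.act X)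
    (hbr : ∀ X Y, f (B.bracket X Y) = B'.bracket (f X) (f Y)) (X : L) (P : ExteriorAlgebra R L) :
    map f (B.lieDeriv X P) = B'.lieDeriv (f X) (map f P) := by
  induction P using ExteriorAlgebra.induction with
  | algebraMap g => simp only [lieDeriv_algebraMap, AlgHom.commutes, hact]
  | ι Y => simp only [lieDeriv_ι, map_apply_ι, hbr]
  | mul a b ha hb => simp only [lieDeriv_mul, map_mul, map_add, ha, hb]
  | add a b ha hb => simp only [map_add, ha, hb]

/-- A linear map that preserves brackets and actions preserves Schouten brackets. -/
theorem map_schouten (hact : ∀ X, B'.act (f X) = B.act X)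
    (hbr : ∀ X Y, f (B.bracket X Y) = B'.bracket (f X) (f Y)) {p : ℕ} (P : ⋀[R]^p L)
    (Q : ExteriorAlgebra R L) :
    map f (B.schouten P Q) = B'.schouten (exteriorPower.map p f P) (map f Q) := by
  induction Q using ExteriorAlgebra.induction with
  | algebraMap g =>
    have hd : B'.d g ∘ₗ f = B.d g := by
      ext X
      rw [LinearMap.comp_apply, d_apply, d_apply, hact]
    rw [AlgHom.commutes, schouten_function, schouten_function, coe_exteriorPower_map,
      contract_map, hd, map_smul]
  | ι Y =>
    rw [map_apply_ι, schouten_vector, schouten_vector, coe_exteriorPower_map, map_neg,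
      map_lieDeriv hact hbr]
  | mul a b ha hb => simp only [schouten_mul_gradeSign, map_mul, map_add, ha, hb, gradeSign_map]
  | add a b ha hb => simp only [map_add, ha, hb]

end Morphism

end LeibnizBracket

/-! ### Jacobi structures on the base -/

section Algebroids

open ExteriorAlgebra LeibnizBracket

variable {E : Type*} [NormedAddCommGroup E] [NormedSpace ℝ E] [FiniteDimensional ℝ E]
  {H : Type*} [TopologicalSpace H] {I : ModelWithCorners ℝ E H}
  {M : Type*} [TopologicalSpace M] [ChartedSpace H M] [IsManifold I ∞ M]
  {F : Type*} [NormedAddCommGroup F] [NormedSpace ℝ F]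
  {A : M → Type*} [TopologicalSpace (Bundle.TotalSpace F A)]
  [∀ x, TopologicalSpace (A x)] [FiberBundle F A]
  [∀ x, AddCommGroup (A x)] [∀ x, Module ℝ (A x)] [VectorBundle ℝ F A]

namespace JacobiAlgebroid

variable (𝒜 : JacobiAlgebroid I F A)

theorem inducedVectorField_add (P Q : AMultivector I F A 2) :
    𝒜.inducedVectorField (P + Q) = 𝒜.inducedVectorField P + 𝒜.inducedVectorField Q := by
  simp only [inducedVectorField, sharp_add, map_add]

theorem inducedBivector_add (P Q : AMultivector I F A 2) :
    𝒜.inducedBivector (P + Q) = 𝒜.inducedBivector P + 𝒜.inducedBivector Q :=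
  map_add _ P Q

variable {𝒜} in
theorem IsJacobiBivector.isJacobiStructure {P : AMultivector I F A 2}
    (hP : 𝒜.IsJacobiBivector P) :
    IsJacobiStructure (𝒜.inducedBivector P) (𝒜.inducedVectorField P) := by
  have hact (X) : (vectorFieldBracket I M).act (𝒜.ρ X) = 𝒜.leibnizBracket.act X := rfl
  have hbr (X Y) : 𝒜.ρ (𝒜.leibnizBracket.bracket X Y) =
      (vectorFieldBracket I M).bracket (𝒜.ρ X) (𝒜.ρ Y) := 𝒜.anchor_bracket X Y
  have hcoe : (𝒜.inducedBivector P : ExteriorAlgebra C^∞⟮I, M; ℝ⟯ (SmoothVectorField I M)) =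
      map 𝒜.ρ P := coe_exteriorPower_map _ 2 P
  have h2 : IsUnit (2 : C^∞⟮I, M; ℝ⟯) := by
    have h : IsUnit (algebraMap ℝ C^∞⟮I, M; ℝ⟯ 2) := (isUnit_iff_ne_zero.2 two_ne_zero).map _
    rwa [map_ofNat] at h
  constructor
  · rw [hcoe]
    refine (map_schouten hact hbr P P).symm.trans ?_
    rw [schouten_self_of_schoutenJacobi_eq_zero _ hP, map_zsmul, map_mul, map_apply_ι]
    rfl
  · rw [schouten_ofVector, hcoe]
    refine (map_lieDeriv hact hbr _ _).symm.trans ?_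
    rw [lieDeriv_sharp_of_schoutenJacobi_eq_zero _ h2 𝒜.closed hP, map_zero]

end JacobiAlgebroid

end Algebroids

theorem mainTheorem3
    {E : Type*} [NormedAddCommGroup E] [NormedSpace ℝ E] [FiniteDimensional ℝ E]
    {H : Type*} [TopologicalSpace H] (I : ModelWithCorners ℝ E H)
    {M : Type*} [TopologicalSpace M] [ChartedSpace H M] [IsManifold I ∞ M]
    [BoundarylessManifold I M] [T2Space M] [SecondCountableTopology M]
    {F : Type*} [NormedAddCommGroup F] [NormedSpace ℝ F] [FiniteDimensional ℝ F]
    {A : M → Type*} [TopologicalSpace (Bundle.TotalSpace F A)]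
    [∀ x, TopologicalSpace (A x)] [FiberBundle F A]
    [∀ x, AddCommGroup (A x)] [∀ x, Module ℝ (A x)] [VectorBundle ℝ F A]
    [ContMDiffVectorBundle ∞ F A I]
    (𝒜 : JacobiAlgebroid I F A) (P₁ P₂ : AMultivector I F A 2)
    (hP : 𝒜.AreCompatible P₁ P₂) :
    AreCompatibleJacobiStructures
      (𝒜.inducedBivector P₁) (𝒜.inducedVectorField P₁)
      (𝒜.inducedBivector P₂) (𝒜.inducedVectorField P₂) := by 
  obtain ⟨h₁, h₂, h₁₂⟩ := hP
  refine ⟨h₁.isJacobiStructure, h₂.isJacobiStructure, ?_⟩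
  rw [← 𝒜.inducedBivector_add, ← 𝒜.inducedVectorField_add]
  exact JacobiAlgebroid.IsJacobiBivector.isJacobiStructure
    (LeibnizBracket.schoutenJacobi_add_self _ h₁ h₂ h₁₂)
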